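/- Let $n\ge 1$ and let $L$ be an $n\times n$ complex Hermitian matrix. Let $S_L$ be the Schur multiplier operator $S_L(A)=L\circ A$ on $n\times n$ complex matrices, where $(L\circ A)_{ij}=L_{ij}A_{ij}$, and let $$\|S_L\|=\sup_{A\neq 0}\frac{\|L\circ A\|}{\|A\|}$$ be its norm induced by the operator (spectral) norm $\|\cdot\|$ on matrices. Then $$\|S_L\|=\max_{x\in\mathbb{C}^n}\{\|L\circ xx^*\|_1:\ \|x\|\le 1\},$$ where $\|Y\|_1=\operatorname{Tr}\big((Y^*Y)^{1/2}\big)$ is the trace norm and $\|x\|$ is the Euclidean norm; in particular, the maximum is attained. -/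

import Mathlib

open scoped Matrix

namespace SchurMult

noncomputable section

/-- The Schur multiplier operator `S_L : A ↦ L ∘ A` (entrywise product). -/
def schurMultiplier {n : ℕ} (L : Matrix (Fin n) (Fin n) ℂ) :
    Matrix (Fin n) (Fin n) ℂ →ₗ[ℂ] Matrix (Fin n) (Fin n) ℂ where
  toFun A := L ⊙ A
  map_add' A B := Matrix.hadamard_add L A B
  map_smul' c A := Matrix.hadamard_smul L A c

/-- The operator (spectral) norm of a matrix, acting on `ℂⁿ` with the Euclidean norm. -/
def opNorm {n : ℕ} (A : Matrix (Fin n) (Fin n) ℂ) : ℝ :=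
  ‖Matrix.toEuclideanCLM (n := Fin n) (𝕜 := ℂ) A‖

/-- The trace norm `‖A‖₁ = tr ((A* A)^{1/2})`, with the square root of the positive
semidefinite matrix `A* A` taken in the functional calculus of Hermitian matrices. -/
def traceNorm {n : ℕ} (A : Matrix (Fin n) (Fin n) ℂ) : ℝ :=
  (cfc Real.sqrt (Aᴴ * A)).trace.re

/-- The norm of a linear map on matrices induced by the operator norm,
`sup_A ‖S A‖ / ‖A‖`. The term at `A = 0` is `0 / 0 = 0` and does not affect the supremum;
the supremum is over a bounded set by `bddAbove_ratio`. -/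
def inducedNorm {n : ℕ} (S : Matrix (Fin n) (Fin n) ℂ →ₗ[ℂ] Matrix (Fin n) (Fin n) ℂ) : ℝ :=
  ⨆ A : Matrix (Fin n) (Fin n) ℂ, opNorm (S A) / opNorm A

theorem bddAbove_ratio {n : ℕ}
    (S : Matrix (Fin n) (Fin n) ℂ →ₗ[ℂ] Matrix (Fin n) (Fin n) ℂ) :
    BddAbove (Set.range fun A : Matrix (Fin n) (Fin n) ℂ => opNorm (S A) / opNorm A) := by
  let e := (Matrix.toEuclideanCLM (n := Fin n) (𝕜 := ℂ)).toAlgEquiv.toLinearEquiv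
  let T := LinearMap.toContinuousLinearMap (e.toLinearMap ∘ₗ S ∘ₗ e.symm.toLinearMap)
  refine ⟨‖T‖, ?_⟩
  rintro _ ⟨A, rfl⟩
  refine div_le_of_le_mul₀ (norm_nonneg _) T.opNorm_nonneg ?_
  have h := T.le_opNorm (e A)
  have h2 : T (e A) = e (S A) := by simp [T]
  rw [h2] at h
  exact h

end

end SchurMult

namespace SchurMult

open Matrix

variable {n : ℕ}

/-! By compactness the norm equals some |⟨u, (L∘A)v⟩| with `A`, `u`, `v` in unit balls. Put r_i² =
(|u_i|² + |v_i|²)/2, so ‖r‖ ≤ 1, and write u = a·r, v = b·r entrywise. The form becomes a pairing of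
`A` with M = L∘rr* scaled by `a`, `b`, where |a_i|² + |b_i|² ≤ 2. Expanding the Hermitian M
spectrally, each eigenvalue λ contributes at most |λ|‖A‖, hence the bound ‖M‖₁
(`norm_sum_scaled_le`). Conversely, ‖L∘xx*‖₁ is the pairing of L∘xx* with a unitary `A`, which is a
quadratic form of L∘A at the conjugate of `x`. So the maximum is attained at r. -/

theorem inner_toEuclideanCLM_eq_sum (A : Matrix (Fin n) (Fin n) ℂ)
    (u v : EuclideanSpace ℂ (Fin n)) :
    inner ℂ u (toEuclideanCLM (n := Fin n) (𝕜 := ℂ) A v) =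
      ∑ i, ∑ j, star (u i) * A i j * v j := by
  simp only [PiLp.inner_apply, RCLike.inner_apply, ofLp_toEuclideanCLM, mulVec, dotProduct,
    Finset.sum_mul]
  refine Finset.sum_congr rfl fun i _ => Finset.sum_congr rfl fun j _ => ?_
  simp only [RCLike.star_def]
  ring

theorem norm_inner_toEuclideanCLM_le (A : Matrix (Fin n) (Fin n) ℂ)
    (u v : EuclideanSpace ℂ (Fin n)) :
    ‖inner ℂ u (toEuclideanCLM (n := Fin n) (𝕜 := ℂ) A v)‖ ≤ opNorm A * (‖u‖ * ‖v‖) := by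
  calc _ ≤ ‖u‖ * ‖toEuclideanCLM (n := Fin n) (𝕜 := ℂ) A v‖ := norm_inner_le_norm _ _
    _ ≤ ‖u‖ * (opNorm A * ‖v‖) := by
      gcongr
      exact ContinuousLinearMap.le_opNorm _ _
    _ = _ := by ring

theorem traceNorm_eq_sum_abs_eigenvalues {M : Matrix (Fin n) (Fin n) ℂ} (hM : M.IsHermitian) :
    traceNorm M = ∑ k, |hM.eigenvalues k| := by
  have hM' : IsSelfAdjoint M := hM
  have h : cfc Real.sqrt (Mᴴ * M) = cfc (fun t : ℝ => |t|) M := by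
    rw [hM.eq, ← sq, ← cfc_pow_id (R := ℝ) M 2, ← cfc_comp' Real.sqrt (fun t : ℝ => t ^ 2) M]
    simp only [Real.sqrt_sq_eq_abs]
  rw [traceNorm, h, hM.cfc_eq, IsHermitian.cfc, Unitary.conjStarAlgAut_apply, trace_mul_comm,
    ← mul_assoc, Unitary.coe_star_mul_self, one_mul]
  simp [trace]

theorem _root_.Matrix.IsHermitian.apply_eq_sum_eigenvalues {M : Matrix (Fin n) (Fin n) ℂ}
    (hM : M.IsHermitian) (i j : Fin n) :
    M i j = ∑ k, (hM.eigenvectorUnitary : Matrix (Fin n) (Fin n) ℂ) i k * hM.eigenvalues k *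
      star ((hM.eigenvectorUnitary : Matrix (Fin n) (Fin n) ℂ) j k) := by
  conv_lhs => rw [hM.spectral_theorem, Unitary.conjStarAlgAut_apply, mul_apply]
  simp [mul_diagonal, star_apply]

theorem sum_norm_sq_eigenvectorUnitary {M : Matrix (Fin n) (Fin n) ℂ}
    (hM : M.IsHermitian) (k : Fin n) :
    ∑ i, ‖(hM.eigenvectorUnitary : Matrix (Fin n) (Fin n) ℂ) i k‖ ^ 2 = 1 := by
  simp_rw [hM.eigenvectorUnitary_apply]
  rw [← EuclideanSpace.norm_sq_eq, hM.eigenvectorBasis.orthonormal.1 k, one_pow]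

/-- Pairing `A` with a two-sided diagonal scaling of a Hermitian matrix `M` whose scaling factors
have mean square at most one. -/
theorem norm_sum_scaled_le {M : Matrix (Fin n) (Fin n) ℂ} (hM : M.IsHermitian)
    (A : Matrix (Fin n) (Fin n) ℂ) {a b : Fin n → ℂ} (hab : ∀ i, ‖a i‖ ^ 2 + ‖b i‖ ^ 2 ≤ 2) :
    ‖∑ i, ∑ j, star (a i) * (M i j * A i j) * b j‖ ≤ opNorm A * traceNorm M := by
  set V : Matrix (Fin n) (Fin n) ℂ := (hM.eigenvectorUnitary : Matrix (Fin n) (Fin n) ℂ) with hV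
  let p : Fin n → EuclideanSpace ℂ (Fin n) := fun k => WithLp.toLp 2 fun i => a i * star (V i k)
  let q : Fin n → EuclideanSpace ℂ (Fin n) := fun k => WithLp.toLp 2 fun i => b i * star (V i k)
  have key : ∑ i, ∑ j, star (a i) * (M i j * A i j) * b j =
      ∑ k, (hM.eigenvalues k : ℂ) *
        inner ℂ (p k) (toEuclideanCLM (n := Fin n) (𝕜 := ℂ) A (q k)) := by
    simp only [inner_toEuclideanCLM_eq_sum, Finset.mul_sum]
    rw [Finset.sum_comm (s := Finset.univ (α := Fin n)) (t := Finset.univ (α := Fin n))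
      (f := fun k i => ∑ j, (hM.eigenvalues k : ℂ) * (star (p k i) * A i j * q k j))]
    refine Finset.sum_congr rfl fun i _ => ?_
    rw [Finset.sum_comm]
    refine Finset.sum_congr rfl fun j _ => ?_
    rw [hM.apply_eq_sum_eigenvalues i j, Finset.sum_mul, Finset.mul_sum, Finset.sum_mul]
    refine Finset.sum_congr rfl fun k _ => ?_
    simp only [p, q, star_mul, star_star, ← hV]
    ring
  -- Either norm alone may exceed 1. Columns of `V` are unit vectors, so the squares sum to at most
  -- 2, and AM-GM bounds the product.
  have hpq (k : Fin n) : ‖p k‖ * ‖q k‖ ≤ 1 := by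
    have h1 : ‖p k‖ ^ 2 + ‖q k‖ ^ 2 ≤ 2 * 1 := by
      rw [← sum_norm_sq_eigenvectorUnitary hM k, EuclideanSpace.norm_sq_eq,
        EuclideanSpace.norm_sq_eq, ← Finset.sum_add_distrib, Finset.mul_sum]
      refine Finset.sum_le_sum fun i _ => ?_
      simp only [p, q, norm_mul, norm_star, mul_pow, ← add_mul, ← hV]
      exact mul_le_mul_of_nonneg_right (hab i) (by positivity)
    nlinarith [sq_nonneg (‖p k‖ - ‖q k‖)]
  rw [key, traceNorm_eq_sum_abs_eigenvalues hM, Finset.mul_sum]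
  refine (norm_sum_le _ _).trans (Finset.sum_le_sum fun k _ => ?_)
  rw [norm_mul, Complex.norm_real, Real.norm_eq_abs, mul_comm]
  gcongr
  calc _ ≤ opNorm A * (‖p k‖ * ‖q k‖) := norm_inner_toEuclideanCLM_le _ _ _
    _ ≤ opNorm A * 1 := mul_le_mul_of_nonneg_left (hpq k) (norm_nonneg _)
    _ = _ := mul_one _

theorem isHermitian_hadamard_vecMulVec {L : Matrix (Fin n) (Fin n) ℂ} (hL : L.IsHermitian)
    (x : Fin n → ℂ) : (L ⊙ vecMulVec x (star x)).IsHermitian := by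
  ext i j
  simp [vecMulVec_apply, ← hL.apply i j, mul_comm]

/-- Symmetrizing `u` and `v` into their entrywise root mean square gives one `z` that serves every
`A`. -/
theorem exists_norm_inner_hadamard_le {L : Matrix (Fin n) (Fin n) ℂ} (hL : L.IsHermitian)
    {u v : EuclideanSpace ℂ (Fin n)} (hu : ‖u‖ ≤ 1) (hv : ‖v‖ ≤ 1) :
    ∃ z : EuclideanSpace ℂ (Fin n), ‖z‖ ≤ 1 ∧ ∀ A : Matrix (Fin n) (Fin n) ℂ,
      ‖inner ℂ u (toEuclideanCLM (n := Fin n) (𝕜 := ℂ) (L ⊙ A) v)‖ ≤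
        opNorm A * traceNorm (L ⊙ vecMulVec z (star (z : Fin n → ℂ))) := by
  let r : Fin n → ℝ := fun i => √((‖u i‖ ^ 2 + ‖v i‖ ^ 2) / 2)
  have hr (i : Fin n) : r i ^ 2 = (‖u i‖ ^ 2 + ‖v i‖ ^ 2) / 2 := Real.sq_sqrt (by positivity)
  have hz (w : EuclideanSpace ℂ (Fin n)) (i : Fin n) (hw : ‖w i‖ ^ 2 ≤ 2 * r i ^ 2) :
      w i / r i * r i = w i := by
    -- If `r i = 0` then `w i = 0`, so the convention 0/0 = 0 is harmless.
    by_cases h : r i = 0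
    · rw [h] at hw
      have : w i = 0 := by
        rw [← norm_eq_zero, ← sq_eq_zero_iff]
        exact le_antisymm (by simpa using hw) (by positivity)
      simp [this]
    · exact div_mul_cancel₀ _ (Complex.ofReal_ne_zero.2 h)
  have hzu (i : Fin n) := hz u i (by rw [hr]; nlinarith [sq_nonneg ‖v i‖])
  have hzv (i : Fin n) := hz v i (by rw [hr]; nlinarith [sq_nonneg ‖u i‖])
  refine ⟨WithLp.toLp 2 fun i => (r i : ℂ), ?_, fun A => ?_⟩
  · rw [← abs_norm, ← sq_le_one_iff_abs_le_one, EuclideanSpace.norm_sq_eq]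
    simp only [Complex.norm_real, Real.norm_eq_abs, sq_abs, hr]
    rw [← Finset.sum_div, Finset.sum_add_distrib, ← EuclideanSpace.norm_sq_eq,
      ← EuclideanSpace.norm_sq_eq]
    nlinarith [norm_nonneg u, norm_nonneg v]
  · have h := norm_sum_scaled_le (isHermitian_hadamard_vecMulVec hL fun i => (r i : ℂ)) A
      (a := fun i => u i / r i) (b := fun i => v i / r i) fun i => by
        by_cases h : r i = 0
        · simp [h]
        · have h2 : 0 < r i ^ 2 := by positivity
          simp only [norm_div, Complex.norm_real, Real.norm_eq_abs, div_pow, sq_abs]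
          rw [← add_div, div_le_iff₀ h2, hr]
          linarith
    rw [inner_toEuclideanCLM_eq_sum]
    convert h using 2
    refine Finset.sum_congr rfl fun i _ => Finset.sum_congr rfl fun j _ => ?_
    conv_lhs => rw [← hzu i, ← hzv j]
    simp only [hadamard_apply, vecMulVec_apply, star_mul, Pi.star_apply, RCLike.star_def,
      Complex.conj_ofReal]
    ring

theorem opNorm_le_one_of_mem_unitary {A : Matrix (Fin n) (Fin n) ℂ}
    (hA : A ∈ unitary (Matrix (Fin n) (Fin n) ℂ)) : opNorm A ≤ 1 := by
  have h := Unitary.map_mem (toEuclideanCLM (n := Fin n) (𝕜 := ℂ)) hA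
  -- For `n = 0` a unitary has norm 0, not 1.
  rcases subsingleton_or_nontrivial
    (EuclideanSpace ℂ (Fin n) →L[ℂ] EuclideanSpace ℂ (Fin n)) with _ | _
  · rw [opNorm, Subsingleton.elim (toEuclideanCLM (n := Fin n) (𝕜 := ℂ) A) 0]
    simp
  · exact (CStarRing.norm_of_mem_unitary h).le

theorem opNorm_le_inducedNorm_mul (S : Matrix (Fin n) (Fin n) ℂ →ₗ[ℂ] Matrix (Fin n) (Fin n) ℂ)
    (A : Matrix (Fin n) (Fin n) ℂ) : opNorm (S A) ≤ inducedNorm S * opNorm A := by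
  by_cases h : opNorm A = 0
  · have h0 : A = 0 := by simpa [opNorm] using h
    simp [h0, opNorm]
  · have hpos : 0 < opNorm A := lt_of_le_of_ne' (norm_nonneg _) h
    rw [← div_le_iff₀ hpos]
    exact le_ciSup (bddAbove_ratio S) A

theorem inducedNorm_nonneg (S : Matrix (Fin n) (Fin n) ℂ →ₗ[ℂ] Matrix (Fin n) (Fin n) ℂ) :
    0 ≤ inducedNorm S :=
  Real.iSup_nonneg fun _ => div_nonneg (norm_nonneg _) (norm_nonneg _)

/-- A Hermitian matrix has its trace norm as pairing with some unitary matrix. -/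
theorem exists_unitary_sum_eq_traceNorm {M : Matrix (Fin n) (Fin n) ℂ} (hM : M.IsHermitian) :
    ∃ A ∈ unitary (Matrix (Fin n) (Fin n) ℂ), ∑ i, ∑ j, M i j * A i j = traceNorm M := by
  let s : Fin n → ℝ := fun k => if 0 ≤ hM.eigenvalues k then 1 else -1
  have hs (k : Fin n) : s k * s k = 1 := by simp only [s]; split_ifs <;> norm_num
  have hs' (k : Fin n) : hM.eigenvalues k * s k = |hM.eigenvalues k| := by
    simp only [s]
    split_ifs with h
    · rw [abs_of_nonneg h, mul_one]
    · rw [abs_of_neg (not_le.1 h), mul_neg_one]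
  let D : Matrix (Fin n) (Fin n) ℂ := diagonal fun k => (s k : ℂ)
  have hD : D ∈ unitary (Matrix (Fin n) (Fin n) ℂ) := by
    rw [Unitary.mem_iff]
    simp [D, star_eq_conjTranspose, diagonal_conjTranspose, Pi.star_def, ← Complex.ofReal_mul, hs]
  set V := hM.eigenvectorUnitary with hV
  let W : Matrix (Fin n) (Fin n) ℂ := V * D * star (V : Matrix (Fin n) (Fin n) ℂ)
  have hW : W ∈ unitary (Matrix (Fin n) (Fin n) ℂ) :=
    mul_mem (mul_mem V.2 hD) (Unitary.star_mem V.2)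
  refine ⟨Wᵀ, transpose_mem_unitaryGroup_iff.2 hW, ?_⟩
  have htr : ∑ i, ∑ j, M i j * Wᵀ i j = (M * W).trace := by
    simp [trace, mul_apply]
  have hMW : M * W = (V : Matrix (Fin n) (Fin n) ℂ) * (diagonal (RCLike.ofReal ∘ hM.eigenvalues) * D) *
      star (V : Matrix (Fin n) (Fin n) ℂ) := by
    conv_lhs => rw [hM.spectral_theorem, Unitary.conjStarAlgAut_apply, ← hV]
    simp only [W, mul_assoc]
    rw [← mul_assoc (star (V : Matrix (Fin n) (Fin n) ℂ)) V, Unitary.coe_star_mul_self, one_mul]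
  rw [htr, hMW, trace_mul_comm, ← mul_assoc, Unitary.coe_star_mul_self, one_mul,
    diagonal_mul_diagonal, trace_diagonal, traceNorm_eq_sum_abs_eigenvalues hM]
  push_cast
  refine Finset.sum_congr rfl fun k _ => ?_
  rw [← hs' k]
  simp

theorem traceNorm_hadamard_vecMulVec_le {L : Matrix (Fin n) (Fin n) ℂ} (hL : L.IsHermitian)
    {x : EuclideanSpace ℂ (Fin n)} (hx : ‖x‖ ≤ 1) :
    traceNorm (L ⊙ vecMulVec x (star (x : Fin n → ℂ))) ≤ inducedNorm (schurMultiplier L) := by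
  obtain ⟨A, hA, h⟩ := exists_unitary_sum_eq_traceNorm
    (isHermitian_hadamard_vecMulVec hL (x : Fin n → ℂ))
  -- Conjugated because `inner` is conjugate-linear in its first slot.
  let y : EuclideanSpace ℂ (Fin n) := WithLp.toLp 2 (star (x : Fin n → ℂ))
  have hy : ‖y‖ ≤ 1 := by
    simpa [y, EuclideanSpace.norm_eq] using hx
  have hxy : (traceNorm (L ⊙ vecMulVec x (star (x : Fin n → ℂ))) : ℂ) =
      inner ℂ y (toEuclideanCLM (n := Fin n) (𝕜 := ℂ) (schurMultiplier L A) y) := by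
    rw [← h, inner_toEuclideanCLM_eq_sum]
    refine Finset.sum_congr rfl fun i _ => Finset.sum_congr rfl fun j _ => ?_
    simp [y, vecMulVec_apply, schurMultiplier]
    ring
  have h1 := inducedNorm_nonneg (schurMultiplier L)
  calc _ ≤ ‖(traceNorm (L ⊙ vecMulVec x (star (x : Fin n → ℂ))) : ℂ)‖ := by
        rw [Complex.norm_real]
        exact le_abs_self _
    _ ≤ opNorm (schurMultiplier L A) * (‖y‖ * ‖y‖) := hxy ▸ norm_inner_toEuclideanCLM_le _ _ _
    _ ≤ opNorm (schurMultiplier L A) * 1 :=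
      mul_le_mul_of_nonneg_left (mul_le_one₀ hy (norm_nonneg _) hy) (norm_nonneg _)
    _ ≤ inducedNorm (schurMultiplier L) * opNorm A := by
      rw [mul_one]
      exact opNorm_le_inducedNorm_mul _ _
    _ ≤ _ := mul_le_of_le_one_right h1 (opNorm_le_one_of_mem_unitary hA)

/-- A continuous function on a compact product of balls has a maximizer; attainment in the theorem
rests on this. -/
theorem exists_inducedNorm_le_norm_inner
    (S : Matrix (Fin n) (Fin n) ℂ →ₗ[ℂ] Matrix (Fin n) (Fin n) ℂ) :
    ∃ (A : Matrix (Fin n) (Fin n) ℂ) (u v : EuclideanSpace ℂ (Fin n)),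
      opNorm A ≤ 1 ∧ ‖u‖ ≤ 1 ∧ ‖v‖ ≤ 1 ∧
      inducedNorm S ≤ ‖inner ℂ u (toEuclideanCLM (n := Fin n) (𝕜 := ℂ) (S A) v)‖ := by
  let E := EuclideanSpace ℂ (Fin n)
  let e := (toEuclideanCLM (n := Fin n) (𝕜 := ℂ)).toAlgEquiv.toLinearEquiv
  let T : (E →L[ℂ] E) →L[ℂ] (E →L[ℂ] E) :=
    LinearMap.toContinuousLinearMap (e.toLinearMap ∘ₗ S ∘ₗ e.symm.toLinearMap)
  have hT (A : Matrix (Fin n) (Fin n) ℂ) : T (e A) = e (S A) := by simp [T]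
  let K : Set ((E →L[ℂ] E) × E × E) :=
    Metric.closedBall 0 1 ×ˢ Metric.closedBall 0 1 ×ˢ Metric.closedBall 0 1
  have : ProperSpace (E →L[ℂ] E) := FiniteDimensional.proper ℂ _
  have hK : IsCompact K := (isCompact_closedBall _ _).prod
    ((isCompact_closedBall _ _).prod (isCompact_closedBall _ _))
  obtain ⟨⟨B, u, v⟩, ⟨hB, hu, hv⟩, hmax⟩ := hK.exists_isMaxOn ⟨0, by simp [K]⟩
    (f := fun p => ‖inner ℂ p.2.1 (T p.1 p.2.2)‖)
    (Continuous.continuousOn (by fun_prop))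
  simp only [Metric.mem_closedBall, dist_zero_right] at hB hu hv
  refine ⟨e.symm B, u, v, ?_, hu, hv, ?_⟩
  · change ‖e (e.symm B)‖ ≤ 1
    rwa [e.apply_symm_apply]
  change _ ≤ ‖inner ℂ u (e (S (e.symm B)) v)‖
  rw [← hT, e.apply_symm_apply]
  have hTle : ‖T‖ ≤ ‖inner ℂ u (T B v)‖ := by
    refine T.opNorm_le_of_unit_norm (norm_nonneg _) fun C hC => ?_
    refine ContinuousLinearMap.opNorm_le_of_re_inner_le (norm_nonneg _) fun x y hx hy => ?_
    rw [← inner_conj_symm, RCLike.conj_re]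
    exact (RCLike.re_le_norm _).trans (isMaxOn_iff.1 hmax ⟨C, y, x⟩ (by simp [K, hC, hx, hy]))
  refine Real.iSup_le (fun A => ?_) (norm_nonneg _)
  refine div_le_of_le_mul₀ (norm_nonneg _) (norm_nonneg _) ?_
  change ‖e (S A)‖ ≤ _ * ‖e A‖
  rw [← hT]
  exact (T.le_opNorm _).trans (by gcongr)

end SchurMult

theorem mainTheorem3 (n : ℕ) (L : Matrix (Fin n) (Fin n) ℂ) (hL : L.IsHermitian) :
    IsGreatest
      {r : ℝ | ∃ x : EuclideanSpace ℂ (Fin n), ‖x‖ ≤ 1 ∧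
        r = SchurMult.traceNorm (L ⊙ Matrix.vecMulVec x (star (x : Fin n → ℂ)))}
      (SchurMult.inducedNorm (SchurMult.schurMultiplier L)) := by
  refine ⟨?_, ?_⟩
  · obtain ⟨A, u, v, hA, hu, hv, h⟩ :=
      SchurMult.exists_inducedNorm_le_norm_inner (SchurMult.schurMultiplier L)
    obtain ⟨z, hz, hz'⟩ := SchurMult.exists_norm_inner_hadamard_le hL hu hv
    refine ⟨z, hz, le_antisymm (h.trans ((hz' A).trans ?_))
      (SchurMult.traceNorm_hadamard_vecMulVec_le hL hz)⟩
    refine mul_le_of_le_one_left ?_ hA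
    rw [SchurMult.traceNorm_eq_sum_abs_eigenvalues (SchurMult.isHermitian_hadamard_vecMulVec hL _)]
    positivity
  · rintro _ ⟨x, hx, rfl⟩
    exact SchurMult.traceNorm_hadamard_vecMulVec_le hL hx
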